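/- For an integer $k\ge 1$ let $\mathcal D_k$ be the set of probability distributions $P=(p_i)$ on $\mathbb N$ all of whose non-zero masses are at least $1/k$, and let $S=S(P)=\#\{i:p_i>0\}$. Under Poisson sampling with parameter $n\ge 1$ (an integer) one observes the histogram $N=(N_i)$ with independent $N_i\sim\mathrm{Poi}(np_i)$. Let $\Phi_j=\#\{i:N_i=j\}$ and $\hat S_{\rm plug}=\#\{i:N_i>0\}$. Given $c_0,c_1>0$ put $L=\lfloor c_0\log k\rfloor$, $l=1/k$, $r=c_1\log k/n$. With $T_L$ the Chebyshev polynomial of degree $L$, let $$P_L(x)=-\frac{T_L\big(\frac{2x-r-l}{r-l}\big)}{T_L\big(\frac{-r-l}{r-l}\big)}=\sum_{m=1}^{L}a_mx^m-1,\qquad u_j=\frac{a_j\,j!}{n^j}\ (1\le j\le L),\qquad \hat S=\hat S_{\rm plug}+\sum_{j=1}^{L}u_j\Phi_j .$$ Let $c_1=0.5$, $c_0\in[0.558,\,0.55835]$ and $0<\kappa\le 4c_0^2/c_1$. (Thus $\kappa=2.494$ is allowed for $c_0=0.55835$, and for $c_0=0.558$ one may take $\kappa=2.490912$.) Put $\delta=\frac{n}{k\log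 k}$. Then, as $\delta\to0$ and $k\to\infty$, for every $P\in\mathcal D_k$ the estimator $\hat S$ has a finite second moment and $$|\mathbb E(\hat S-S)|\le 2S\,(1+o_k(1))\exp\Big(-(1+o_\delta(1))\sqrt{\kappa\tfrac{n\log k}{k}}\Big),\qquad \mathrm{var}[\hat S]\le O(S\,k^{c})$$ for some constant $c<1$, and consequently $$\sup_{P\in\mathcal D_k}\mathbb E(\hat S-S)^2\le 4k^2(1+o_k(1))\exp\Big(-(2+o_\delta(1))\sqrt{\kappa\tfrac{n\log k}{k}}\Big).$$ Here $o_k(1)$ is a function of $k$ alone that tends to $0$ as $k\to\infty$, $o_\delta(1)$ is a function of $\delta$ alone that tends to $0$ as $\delta\to0^+$, and the bounds hold, with $c$, the constant in $O(\cdot)$ and these functions independent of $k$, $n$ and $P$, for all $k\ge k_0$ and $n\ge 1$ with $0<\delta\le\delta_0$, for some $k_0$ and $\delta_0>0$. -/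

import Mathlib

open MeasureTheory ProbabilityTheory Polynomial Filter Topology
open scoped NNReal ENNReal

namespace SupportSize

noncomputable section

/-- The class `𝒟_k`: probability distributions on `ℕ` all of whose non-zero masses are at
least `1 / k`. -/
def distClass (k : ℕ) : Set (PMF ℕ) :=
  {P | ∀ i, P i ≠ 0 → 1 / (k : ℝ) ≤ (P i).toReal}

/-- The support size `S(P) = #{i : p_i > 0}`. -/
def suppSize (P : PMF ℕ) : ℝ := (Set.ncard {i | P i ≠ 0} : ℝ)

/-- The law of the histogram `N = (N_0, N_1, …)` under Poisson sampling: the `N_i` are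
independent and `N_i ∼ Poi(n p_i)`. -/
def histLaw (n : ℕ) (P : PMF ℕ) : Measure (ℕ → ℕ) :=
  Measure.infinitePi fun i => poissonMeasure ((n : ℝ≥0) * (P i).toNNReal)

/-- The fingerprint `Φ_j`: the number of symbols that appear exactly `j` times. -/
def fingerprint (j : ℕ) (N : ℕ → ℕ) : ℝ := (Set.ncard {i | N i = j} : ℝ)

/-- The plug-in estimator: the number of observed symbols. -/
def plugIn (N : ℕ → ℕ) : ℝ := (Set.ncard {i | 0 < N i} : ℝ)

/-- The shifted and scaled Chebyshev polynomial over `[l, r]`,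
`P_L(x) = - T_L((2x - r - l) / (r - l)) / T_L((-r - l) / (r - l))`. -/
def shiftedCheb (L : ℕ) (l r : ℝ) : ℝ[X] :=
  -(C (((Chebyshev.T ℝ L).eval ((-r - l) / (r - l)))⁻¹ : ℝ) *
    (Chebyshev.T ℝ L).comp (C (2 / (r - l)) * X - C ((r + l) / (r - l))))

/-- The degree `L = ⌊c₀ log k⌋`. -/
def degL (c₀ : ℝ) (k : ℕ) : ℕ := ⌊c₀ * Real.log k⌋₊

/-- The coefficients `u_j = a_j j! / n ^ j`, where `a_j` is the `j`-th coefficient of `P_L` for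
the interval with end points `l = 1 / k` and `r = c₁ log k / n`. They are used for
`1 ≤ j ≤ L` only. -/
def chebCoeff (c₀ c₁ : ℝ) (k n j : ℕ) : ℝ :=
  (shiftedCheb (degL c₀ k) (1 / (k : ℝ)) (c₁ * Real.log k / n)).coeff j * (j.factorial : ℝ)
    / (n : ℝ) ^ j

/-- The linear estimator `Ŝ = Ŝ_plug + ∑_{1 ≤ j ≤ L} u_j Φ_j`. -/
def chebEst (c₀ c₁ : ℝ) (k n : ℕ) (N : ℕ → ℕ) : ℝ :=
  plugIn N + ∑ j ∈ Finset.Icc 1 (degL c₀ k), chebCoeff c₀ c₁ k n j * fingerprint j N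

/-- The worst-case mean squared error `sup_{P ∈ 𝒟_k} E (Ŝ(N) - S(P))²` under Poisson sampling. -/
def worstCaseMSE (k n : ℕ) (Shat : (ℕ → ℕ) → ℝ) : ℝ≥0∞ :=
  ⨆ P ∈ distClass k, ∫⁻ N, ENNReal.ofReal ((Shat N - suppSize P) ^ 2) ∂(histLaw n P)

end

end SupportSize

namespace SupportSize

/-! ### Chebyshev polynomials outside `[-1, 1]` -/

/-! Put `M = log k`, so `r = M / (2n)` and `l / r = 2δ`, and let `u_0 = -1`. A symbol seen `m` times
contributes `u_m` to `Ŝ - S` if `m ≤ L` and nothing otherwise (`symbolError`). The bias is therefore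
the sum of `exp (-n p) P_L(p)` over the support, and the variance is at most `S max u_m²`.

One inequality, `0.55835 v ≤ 0.249999 (1 + cosh v)`, controls both. It gives `T_L(y) ≤ exp (0.249999
M (1 + y))` for `y ≥ 1` (`eval_T_le_exp`). Bias: beyond `r` this growth is at most `exp (n p)`, so
the Poisson weight absorbs it. What remains is `1 / T_L((r + l) / (r - l)) ≤ 2 exp (-2 L √(2δ))`,
and `L ≈ c₀ M` gives the rate `√(8 c₀² n log k / k)`. Variance: `a_j` is dominated by the
coefficient of a polynomial with nonnegative coefficients. Evaluating that polynomial at `j / n`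
costs `exp (M / 2 + j)`, and `j!` cancels `exp j`, so `|u_j|` is just below `√k` in order. Since `S
≤ k`, the variance is smaller than `k²` by a power of `k`, which for small `δ` beats `exp (-2√(κ n
log k / k))`. -/

lemma log_tangent_point_le : Real.log 4.68048 ≤ 1.543401 := by
  -- The Taylor series is applied near `1`, through `4.68048 = (9 / 2) * 1.0401066…`.
  have h := Real.abs_log_sub_add_sum_range_le (x := -(0.04010666666666667 : ℝ))
    (by rw [abs_lt]; constructor <;> norm_num) 4
  rw [abs_neg, abs_of_pos (by norm_num : (0 : ℝ) < 0.04010666666666667)] at h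
  have h' := (abs_le.1 h).2
  norm_num [Finset.sum_range_succ] at h'
  have h3 := Real.log_three_lt_d9
  have h2 := Real.log_two_gt_d9
  have : Real.log 4.68048 ≤
      Real.log (3 ^ 2 / 2 * (104010666666666667 / 100000000000000000)) :=
    Real.log_le_log (by norm_num) (by norm_num)
  rw [Real.log_mul (by norm_num) (by norm_num), Real.log_div (by norm_num) (by norm_num),
    Real.log_pow] at this
  push_cast at this
  linarith

/-- By convexity, `cosh` lies above its tangent. The constant `0.55835` is just below `min (1 + cosh
v) / (4 v) ≈ 0.558355`; the loss from `1 / 4` to `0.249999` pays for all later approximations. -/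
lemma linear_le_one_add_cosh {v : ℝ} (hv : 0 ≤ v) :
    0.55835 * v ≤ 0.249999 * (1 + Real.cosh v) := by
  -- Approximate minimiser of the difference of the two sides, where `sinh v = 0.55835 / 0.249999`.
  set b := Real.log 4.68048
  have hb : b ≤ 1.543401 := log_tangent_point_le
  have hexp : Real.exp b = 4.68048 := Real.exp_log (by norm_num)
  clear_value b
  have h1 : 4.68048 * (1 + (v - b)) ≤ Real.exp v := by
    have : Real.exp v = 4.68048 * Real.exp (v - b) := by
      rw [← hexp, ← Real.exp_add]; congr 1; ring
    rw [this]
    have := Real.add_one_le_exp (v - b)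
    linarith
  have h2 : (4.68048 : ℝ)⁻¹ * (1 - (v - b)) ≤ Real.exp (-v) := by
    have : Real.exp (-v) = (4.68048 : ℝ)⁻¹ * Real.exp (-(v - b)) := by
      rw [← hexp, ← Real.exp_neg, ← Real.exp_add]; congr 1; ring
    rw [this]
    have := Real.add_one_le_exp (-(v - b))
    have h0 : (0 : ℝ) < (4.68048 : ℝ)⁻¹ := by norm_num
    nlinarith
  rw [Real.cosh_eq]
  norm_num at h1 h2 hb ⊢
  linarith

lemma eval_T_le_exp {L : ℕ} {M y : ℝ} (hM : 0 ≤ M) (hL : (L : ℝ) ≤ 0.55835 * M) (hy : 1 ≤ y) :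
    (Chebyshev.T ℝ L).eval y ≤ Real.exp (0.249999 * M * (1 + y)) := by
  obtain ⟨v, hv, rfl⟩ : ∃ v, 0 ≤ v ∧ Real.cosh v = y :=
    ⟨Real.arcosh y, Real.arcosh_nonneg hy, Real.cosh_arcosh hy⟩
  rw [Chebyshev.T_real_cosh]
  have h0 : 0 ≤ (((L : ℕ) : ℤ) : ℝ) * v := by positivity
  have h1 : Real.cosh ((((L : ℕ) : ℤ) : ℝ) * v) ≤ Real.exp ((((L : ℕ) : ℤ) : ℝ) * v) := by
    rw [← Real.cosh_add_sinh]
    linarith [Real.sinh_nonneg_iff.2 h0]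
  refine h1.trans (Real.exp_le_exp.2 ?_)
  have := linear_le_one_add_cosh hv
  push_cast
  calc (L : ℝ) * v ≤ 0.55835 * M * v := by gcongr
    _ = M * (0.55835 * v) := by ring
    _ ≤ M * (0.249999 * (1 + Real.cosh v)) := by gcongr
    _ = _ := by ring

/-- The argument is `cosh (log ((1 + w) / (1 - w)))`, and this logarithm is at least `2w`. With `w =
√(l / r)` the argument becomes `(r + l) / (r - l)`. -/
lemma exp_le_eval_T (L : ℕ) {w : ℝ} (hw : 0 ≤ w) (hw1 : w < 1) :
    Real.exp (L * (2 * w)) / 2 ≤ (Chebyshev.T ℝ L).eval ((1 + w ^ 2) / (1 - w ^ 2)) := by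
  have hpos : 0 < 1 - w := by linarith
  have hq : 0 < (1 + w) / (1 - w) := by positivity
  have hcosh : (1 + w ^ 2) / (1 - w ^ 2) = Real.cosh (Real.log ((1 + w) / (1 - w))) := by
    rw [Real.cosh_eq, Real.exp_neg, Real.exp_log hq]
    have : 1 - w ^ 2 ≠ 0 := by nlinarith
    field_simp
    ring
  have hlog : 2 * w ≤ Real.log ((1 + w) / (1 - w)) := by
    have := Real.le_log_one_add_of_nonneg (x := 2 * w / (1 - w)) (by positivity)
    convert this using 1
    · field_simp; ring
    · congr 1; field_simp; ring
  rw [hcosh, Chebyshev.T_real_cosh, Real.cosh_eq]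
  have h1 : Real.exp (L * (2 * w)) ≤ Real.exp (((L : ℤ) : ℝ) * Real.log ((1 + w) / (1 - w))) := by
    push_cast
    gcongr
  have := Real.exp_pos (-(((L : ℤ) : ℝ) * Real.log ((1 + w) / (1 - w))))
  linarith

/-! ### Coefficients of composed Chebyshev polynomials -/

lemma coeff_mul_nonneg {p q : ℝ[X]} (hp : ∀ i, 0 ≤ p.coeff i) (hq : ∀ i, 0 ≤ q.coeff i) (i : ℕ) :
    0 ≤ (p * q).coeff i := by
  rw [coeff_mul]
  exact Finset.sum_nonneg fun x _ => mul_nonneg (hp _) (hq _)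

/-- The recurrence of `T` has a minus sign, so the induction also carries the increments: `T_{L+2} -
T_{L+1} = (T_{L+1} - T_L) + 2 (q - 1) T_{L+1}` after composing with `q`. -/
lemma coeff_T_comp_nonneg {q : ℝ[X]} (hq : ∀ i, 0 ≤ (q - 1).coeff i) (L i : ℕ) :
    0 ≤ ((Chebyshev.T ℝ L).comp q).coeff i := by
  have h1 : ∀ i, 0 ≤ (1 : ℝ[X]).coeff i := fun i => by rw [coeff_one]; split_ifs <;> norm_num
  suffices h : ∀ L : ℕ, (∀ i, 0 ≤ ((Chebyshev.T ℝ L).comp q).coeff i) ∧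
      ∀ i, 0 ≤ ((Chebyshev.T ℝ (L + 1)).comp q - (Chebyshev.T ℝ L).comp q).coeff i from
    (h L).1 i
  intro L
  induction L with
  | zero => exact ⟨by simpa using h1, fun i => by simpa using hq i⟩
  | succ L ih =>
    obtain ⟨ih1, ih2⟩ := ih
    have h3 : ∀ i, 0 ≤ ((Chebyshev.T ℝ (L + 1)).comp q).coeff i := fun i => by
      have := ih2 i
      rw [coeff_sub] at this
      linarith [ih1 i]
    refine ⟨by exact_mod_cast h3, fun i => ?_⟩
    have heq : (Chebyshev.T ℝ ((L + 1 : ℕ) + 1)).comp q - (Chebyshev.T ℝ (L + 1 : ℕ)).comp q =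
        ((Chebyshev.T ℝ (L + 1)).comp q - (Chebyshev.T ℝ L).comp q) +
        2 * ((q - 1) * (Chebyshev.T ℝ (L + 1)).comp q) := by
      push_cast
      rw [show (L : ℤ) + 1 + 1 = L + 2 by ring, Chebyshev.T_add_two]
      simp only [sub_comp, mul_comp, X_comp, ofNat_comp]
      ring
    rw [heq, coeff_add, two_mul, coeff_add]
    have := coeff_mul_nonneg hq h3 i
    linarith [ih2 i]

/-- By the parity of `T_L`, replacing `x` by `-x` only changes signs of coefficients. -/
lemma abs_coeff_T_comp_le (L j : ℕ) {a b : ℝ} (ha : 0 ≤ a) (hb : 1 ≤ b) :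
    |((Chebyshev.T ℝ L).comp (C a * X - C b)).coeff j| ≤
      ((Chebyshev.T ℝ L).comp (C a * X + C b)).coeff j := by
  have hnn : 0 ≤ ((Chebyshev.T ℝ L).comp (C a * X + C b)).coeff j := by
    refine coeff_T_comp_nonneg (fun i => ?_) L j
    rcases i with _ | _ | i
    · simpa using hb
    · simpa [coeff_one] using ha
    · simp [coeff_one]
  have heq : (Chebyshev.T ℝ L).comp (C a * X - C b) =
      C ((((L : ℤ).negOnePow : ℤ) : ℝ)) *
        ((Chebyshev.T ℝ L).comp (C a * X + C b)).comp (C (-1) * X) := by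
    refine Polynomial.funext fun x => ?_
    have := Chebyshev.T_eval_neg (R := ℝ) L (a * (-x) + b)
    simp only [eval_comp, eval_mul, eval_C, eval_sub, eval_X, eval_add]
    rw [neg_one_mul, ← this]
    congr 1
    ring
  rw [heq, coeff_C_mul, abs_mul, comp_C_mul_X_coeff, abs_mul, abs_of_nonneg hnn]
  simp

lemma coeff_mul_pow_le_eval {p : ℝ[X]} (hp : ∀ i, 0 ≤ p.coeff i) {x : ℝ} (hx : 0 ≤ x) (j : ℕ) :
    p.coeff j * x ^ j ≤ p.eval x := by
  by_cases hj : j ≤ p.natDegree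
  · rw [eval_eq_sum_range]
    exact Finset.single_le_sum (f := fun i => p.coeff i * x ^ i)
      (fun i _ => mul_nonneg (hp i) (pow_nonneg hx i)) (Finset.mem_range.2 (by omega))
  · rw [coeff_eq_zero_of_natDegree_lt (by omega), zero_mul, eval_eq_sum_range]
    exact Finset.sum_nonneg fun i _ => mul_nonneg (hp i) (pow_nonneg hx i)

/-- A Stirling-type upper bound; the induction step is `(1 + 1 / j) ^ (j + 1) ≥ e`. -/
lemma factorial_mul_exp_le (j : ℕ) (hj : 1 ≤ j) :
    (j.factorial : ℝ) * Real.exp j ≤ Real.exp 1 * j * (j : ℝ) ^ j := by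
  induction j, hj using Nat.le_induction with
  | base => simp
  | succ j hj ih =>
    have hj' : (0 : ℝ) < j := by exact_mod_cast hj
    have key : Real.exp 1 * (j : ℝ) ^ (j + 1) ≤ ((j : ℝ) + 1) ^ (j + 1) := by
      have h1 : (j : ℝ) / (j + 1) ≤ Real.exp (-(1 / (j + 1))) := by
        have := Real.add_one_le_exp (-(1 / ((j : ℝ) + 1)))
        refine le_trans (le_of_eq ?_) this
        field_simp
        ring
      have h2 := pow_le_pow_left₀ (by positivity) h1 (j + 1)
      rw [← Real.exp_nat_mul] at h2
      have h3 : ((j + 1 : ℕ) : ℝ) * -(1 / ((j : ℝ) + 1)) = -1 := by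
        push_cast; field_simp
      rw [h3, div_pow, div_le_iff₀ (by positivity)] at h2
      calc Real.exp 1 * (j : ℝ) ^ (j + 1)
          ≤ Real.exp 1 * (Real.exp (-1) * ((j : ℝ) + 1) ^ (j + 1)) := by gcongr
        _ = _ := by rw [← mul_assoc, ← Real.exp_add]; simp
    rw [Nat.factorial_succ]
    push_cast
    rw [Real.exp_add]
    calc ((j : ℝ) + 1) * j.factorial * (Real.exp j * Real.exp 1)
        = (j + 1) * Real.exp 1 * (j.factorial * Real.exp j) := by ring
      _ ≤ (j + 1) * Real.exp 1 * (Real.exp 1 * j * (j : ℝ) ^ j) := by gcongr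
      _ = (j + 1) * Real.exp 1 * (Real.exp 1 * (j : ℝ) ^ (j + 1)) := by ring
      _ ≤ (j + 1) * Real.exp 1 * ((j : ℝ) + 1) ^ (j + 1) := by gcongr
      _ = _ := by ring

/-! ### The shifted polynomial `P_L` -/

lemma abs_eval_T_left_endpoint (L : ℕ) {l r : ℝ} (hl : 0 ≤ l) (hlr : l < r) :
    |(Chebyshev.T ℝ L).eval ((-r - l) / (r - l))| =
      (Chebyshev.T ℝ L).eval ((r + l) / (r - l)) := by
  have h : (-r - l) / (r - l) = -((r + l) / (r - l)) := by ring
  have h1 : 1 ≤ (r + l) / (r - l) := by rw [le_div_iff₀ (by linarith)]; linarith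
  have h2 := Chebyshev.one_le_eval_T_real L h1
  rw [h, Chebyshev.T_eval_neg, abs_mul, abs_of_pos (a := eval _ _) (by linarith)]
  rcases Int.units_eq_one_or ((L : ℤ).negOnePow) with h | h <;> simp [h]

lemma shiftedCheb_eval_zero (L : ℕ) {l r : ℝ} (hl : 0 ≤ l) (hlr : l < r) :
    (shiftedCheb L l r).eval 0 = -1 := by
  have h1 : 1 ≤ (r + l) / (r - l) := by rw [le_div_iff₀ (by linarith)]; linarith
  have h2 := Chebyshev.one_le_eval_T_real L h1
  have h3 : (Chebyshev.T ℝ L).eval ((-r - l) / (r - l)) ≠ 0 := by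
    rw [← abs_pos, abs_eval_T_left_endpoint L hl hlr]
    linarith
  have h4 : -((r + l) / (r - l)) = (-r - l) / (r - l) := by ring
  simp only [shiftedCheb, eval_neg, eval_mul, eval_C, eval_comp, eval_sub, eval_X, mul_zero,
    zero_sub, h4, inv_mul_cancel₀ h3]

lemma natDegree_shiftedCheb_le (L : ℕ) (l r : ℝ) : (shiftedCheb L l r).natDegree ≤ L := by
  rw [shiftedCheb, natDegree_neg]
  refine (natDegree_C_mul_le _ _).trans (natDegree_comp_le.trans ?_)
  have h1 : (Chebyshev.T ℝ L).natDegree ≤ L := by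
    simp [Chebyshev.natDegree_T]
  have h2 : (C (2 / (r - l)) * X - C ((r + l) / (r - l))).natDegree ≤ 1 := by
    compute_degree
  calc _ ≤ L * 1 := Nat.mul_le_mul h1 h2
    _ = L := mul_one L

lemma abs_eval_shiftedCheb (L : ℕ) {l r : ℝ} (hl : 0 ≤ l) (hlr : l < r) (x : ℝ) :
    |(shiftedCheb L l r).eval x| =
      |(Chebyshev.T ℝ L).eval ((2 * x - r - l) / (r - l))| /
        (Chebyshev.T ℝ L).eval ((r + l) / (r - l)) := by
  have h4 : 2 / (r - l) * x - (r + l) / (r - l) = (2 * x - r - l) / (r - l) := by ring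
  rw [← abs_eval_T_left_endpoint L hl hlr]
  simp only [shiftedCheb, eval_neg, eval_mul, eval_C, eval_comp, eval_sub, eval_X, h4]
  rw [abs_neg, abs_mul, abs_inv]
  exact (div_eq_inv_mul _ _).symm

/-- The weight `exp (-n x)`, with `n = M / (2 r)`, compensates for the growth of `P_L` beyond
`r`. -/
lemma exp_neg_mul_abs_eval_shiftedCheb_le {L : ℕ} {M l r x : ℝ} (hM : 0 ≤ M)
    (hL : (L : ℝ) ≤ 0.55835 * M) (hl : 0 < l) (hlr : l ≤ 1e-6 * r) (hx : l ≤ x) :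
    Real.exp (-(M / (2 * r) * x)) * |(shiftedCheb L l r).eval x| ≤
      2 * Real.exp (-(L * (2 * √(l / r)))) := by
  have hr : 0 < r := by norm_num at hlr; linarith
  have hlr' : l < r := by norm_num at hlr; linarith
  have hrl : 0 < r - l := by linarith
  have hw : √(l / r) ^ 2 = l / r := Real.sq_sqrt (by positivity)
  have hD : Real.exp (L * (2 * √(l / r))) / 2 ≤ (Chebyshev.T ℝ L).eval ((r + l) / (r - l)) := by
    have := exp_le_eval_T L (Real.sqrt_nonneg (l / r)) (by
      rw [Real.sqrt_lt' one_pos, one_pow, div_lt_one hr]; exact hlr')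
    rw [hw] at this
    convert this using 2
    field_simp
  have hnum : Real.exp (-(M / (2 * r) * x)) *
      |(Chebyshev.T ℝ L).eval ((2 * x - r - l) / (r - l))| ≤ 1 := by
    rcases le_total x r with hxr | hxr
    · have h1 : |(Chebyshev.T ℝ L).eval ((2 * x - r - l) / (r - l))| ≤ 1 := by
        refine Chebyshev.abs_eval_T_real_le_one L ?_
        rw [abs_le, le_div_iff₀ hrl, div_le_iff₀ hrl]
        constructor <;> linarith
      have h2 : Real.exp (-(M / (2 * r) * x)) ≤ 1 := by
        rw [Real.exp_le_one_iff, neg_nonpos]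
        have : 0 ≤ x := by linarith
        positivity
      calc _ ≤ (1 : ℝ) * 1 := by gcongr
        _ = 1 := one_mul 1
    · have hy : 1 ≤ (2 * x - r - l) / (r - l) := by rw [le_div_iff₀ hrl]; linarith
      have h1 := eval_T_le_exp hM hL hy
      have h2 := Chebyshev.one_le_eval_T_real L hy
      rw [abs_of_pos (by linarith)]
      refine (mul_le_mul_of_nonneg_left h1 (Real.exp_pos _).le).trans ?_
      rw [← Real.exp_add, Real.exp_le_one_iff]
      have h3 : 1 + (2 * x - r - l) / (r - l) = 2 * (x - l) / (r - l) := by field_simp; ring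
      -- The slack `0.249999 < 1 / 4` absorbs the replacement of `r - l` by `r`.
      have h4 : 0.249999 * (2 * (x - l) / (r - l)) ≤ x / (2 * r) := by
        rw [mul_div_assoc', div_le_div_iff₀ hrl (by positivity)]
        norm_num at hlr ⊢
        nlinarith
      rw [h3]
      have h5 := mul_le_mul_of_nonneg_left h4 hM
      have h6 : M / (2 * r) * x = M * (x / (2 * r)) := by ring
      rw [h6]
      linarith
  rw [abs_eval_shiftedCheb L hl.le hlr', mul_div_assoc',
    div_le_iff₀ (lt_of_lt_of_le (by positivity) hD)]
  refine hnum.trans ?_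
  rw [Real.exp_neg]
  calc (1 : ℝ) = 2 * (Real.exp (L * (2 * √(l / r))))⁻¹ * (Real.exp (L * (2 * √(l / r))) / 2) := by
        field_simp
    _ ≤ _ := by gcongr

/-- The coefficients of the estimator are at most `exp (0.499999 M)` up to the factor `e j`. -/
lemma abs_coeff_shiftedCheb_mul_le {L j : ℕ} {M l r : ℝ} (hM : 0 < M)
    (hL : (L : ℝ) ≤ 0.55835 * M) (hl : 0 < l) (hlr : l ≤ 1e-6 * r) (hj : 1 ≤ j) :
    |(shiftedCheb L l r).coeff j| * j.factorial / (M / (2 * r)) ^ j ≤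
      Real.exp 1 * j * Real.exp (0.499999 * M) := by
  have hr : 0 < r := by norm_num at hlr; linarith
  have hlr' : l < r := by norm_num at hlr; linarith
  have hrl : 0 < r - l := by linarith
  have hj' : (0 : ℝ) < j := by exact_mod_cast hj
  have hb : 1 ≤ (r + l) / (r - l) := by rw [le_div_iff₀ hrl]; linarith
  set n := M / (2 * r) with hn
  have hn0 : 0 < n := by positivity
  set p := (Chebyshev.T ℝ L).comp (C (2 / (r - l)) * X + C ((r + l) / (r - l))) with hp
  have hple (i : ℕ) := abs_coeff_T_comp_le L i (a := 2 / (r - l)) (b := (r + l) / (r - l))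
    (by positivity) hb
  have hpn (i : ℕ) : 0 ≤ p.coeff i := (abs_nonneg _).trans (hple i)
  have h1 : |(shiftedCheb L l r).coeff j| ≤ p.coeff j := by
    rw [shiftedCheb, coeff_neg, abs_neg, coeff_C_mul, abs_mul, abs_inv,
      abs_eval_T_left_endpoint L hl.le hlr']
    refine (mul_le_of_le_one_left (abs_nonneg _) ?_).trans (hple j)
    exact inv_le_one_of_one_le₀ (Chebyshev.one_le_eval_T_real L hb)
  -- The point `j / n` makes the exponent about `M / 2 + j`, whose `j` cancels against Stirling.
  have h2 : p.coeff j * (j / n) ^ j ≤ Real.exp (0.499999 * M + j) := by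
    refine (coeff_mul_pow_le_eval hpn (by positivity) j).trans ?_
    simp only [hp, eval_comp, eval_add, eval_mul, eval_C, eval_X]
    have hy : 1 ≤ 2 / (r - l) * (j / n) + (r + l) / (r - l) := by
      have : 0 ≤ 2 / (r - l) * (j / n) := by positivity
      linarith
    refine (eval_T_le_exp hM.le hL hy).trans (Real.exp_le_exp.2 ?_)
    have h3 : 0.249999 * M * (1 + (2 / (r - l) * (j / n) + (r + l) / (r - l))) =
        (0.499998 * r / (r - l)) * (M + 2 * j) := by
      rw [hn]; field_simp; ring
    have h4 : 0.499998 * r / (r - l) ≤ 0.499999 := by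
      rw [div_le_iff₀ hrl]; norm_num at hlr ⊢; linarith
    rw [h3]
    calc _ ≤ 0.499999 * (M + 2 * (j : ℝ)) := by gcongr
      _ ≤ _ := by norm_num; linarith
  have h5 := factorial_mul_exp_le j hj
  rw [Real.exp_add] at h2
  rw [div_le_iff₀ (by positivity)]
  have h6 : |(shiftedCheb L l r).coeff j| * (j : ℝ) ^ j ≤
      Real.exp (0.499999 * M) * Real.exp j * n ^ j := by
    rw [div_pow, mul_div_assoc', div_le_iff₀ (by positivity)] at h2
    exact (mul_le_mul_of_nonneg_right h1 (by positivity)).trans h2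
  have h7 : 0 < Real.exp j * (j : ℝ) ^ j := by positivity
  refine le_of_mul_le_mul_right ?_ h7
  calc |(shiftedCheb L l r).coeff j| * j.factorial * (Real.exp j * (j : ℝ) ^ j)
      = (|(shiftedCheb L l r).coeff j| * (j : ℝ) ^ j) * (j.factorial * Real.exp j) := by ring
    _ ≤ (Real.exp (0.499999 * M) * Real.exp j * n ^ j) *
        (Real.exp 1 * j * (j : ℝ) ^ j) := by gcongr
    _ = _ := by ring

/-! ### The support and the Poisson histogram -/

lemma card_le_of_subset_support {k : ℕ} {P : PMF ℕ} (hP : P ∈ distClass k) (hk : 1 ≤ k)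
    (s : Finset ℕ) (hs : ∀ i ∈ s, P i ≠ 0) : s.card ≤ k := by
  have hk' : (0 : ℝ) < k := by exact_mod_cast hk
  have h1 : (s.card : ℝ) * (1 / k) ≤ ∑ i ∈ s, (P i).toReal := by
    rw [← nsmul_eq_mul]
    exact Finset.card_nsmul_le_sum _ _ _ fun i hi => hP i (hs i hi)
  have h2 : ∑ i ∈ s, (P i).toReal ≤ 1 := by
    rw [← ENNReal.toReal_sum fun i _ => P.apply_ne_top i]
    refine ENNReal.toReal_le_of_le_ofReal one_pos.le ?_
    rw [ENNReal.ofReal_one, ← P.tsum_coe]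
    exact ENNReal.sum_le_tsum s
  have h3 := h1.trans h2
  rw [mul_one_div, div_le_one hk'] at h3
  exact_mod_cast h3

lemma finite_support {k : ℕ} {P : PMF ℕ} (hP : P ∈ distClass k) (hk : 1 ≤ k) :
    {i | P i ≠ 0}.Finite := by
  by_contra h
  obtain ⟨s, hs, hcard⟩ := Set.Infinite.exists_subset_card_eq h (k + 1)
  have := card_le_of_subset_support hP hk s fun i hi => hs hi
  omega

lemma suppSize_eq_card {P : PMF ℕ} (hfin : {i | P i ≠ 0}.Finite) :
    suppSize P = hfin.toFinset.card := by
  rw [suppSize, Set.ncard_eq_toFinset_card _ hfin]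

instance (n : ℕ) (P : PMF ℕ) : IsProbabilityMeasure (histLaw n P) := by
  unfold histLaw
  infer_instance

lemma measurePreserving_eval_histLaw (n : ℕ) (P : PMF ℕ) (i : ℕ) :
    MeasurePreserving (fun N : ℕ → ℕ => N i) (histLaw n P)
      (poissonMeasure ((n : ℝ≥0) * (P i).toNNReal)) :=
  measurePreserving_eval_infinitePi _ i

lemma ae_eq_zero_of_notMem_support (n : ℕ) (P : PMF ℕ) :
    ∀ᵐ N ∂histLaw n P, ∀ i, P i = 0 → N i = 0 := by
  rw [ae_all_iff]
  intro i
  by_cases hi : P i = 0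
  · have h0 : ∀ᵐ m ∂poissonMeasure ((n : ℝ≥0) * (P i).toNNReal), m = 0 := by
      have : poissonMeasure ((n : ℝ≥0) * (P i).toNNReal) {0} = 1 := by
        simp [poissonMeasure_singleton, hi]
      exact mem_ae_iff_prob_eq_one (.of_discrete) |>.2 this
    filter_upwards [(measurePreserving_eval_histLaw n P i).quasiMeasurePreserving.ae h0]
      with N hN _ using hN
  · simp [hi]

lemma memLp_comp_eval {n : ℕ} {P : PMF ℕ} {h : ℕ → ℝ} {B : ℝ} (hB : ∀ m, |h m| ≤ B) (i : ℕ) :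
    MemLp (fun N : ℕ → ℕ => h (N i)) 2 (histLaw n P) :=
  MemLp.of_bound ((measurable_of_countable h).comp (measurable_pi_apply i)).aestronglyMeasurable B
    (.of_forall fun N => hB (N i))

lemma iIndepFun_comp_eval {n : ℕ} {P : PMF ℕ} (h : ℕ → ℝ) :
    iIndepFun (fun i (N : ℕ → ℕ) => h (N i)) (histLaw n P) := by
  unfold histLaw
  exact iIndepFun_infinitePi (X := fun _ => h) fun _ => measurable_of_countable h

lemma variance_sum_comp_eval_le {n : ℕ} {P : PMF ℕ} {h : ℕ → ℝ} {B : ℝ} (hB : ∀ m, |h m| ≤ B)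
    (s : Finset ℕ) :
    Var[fun N => ∑ i ∈ s, h (N i); histLaw n P] ≤ s.card * B ^ 2 := by
  have hindep : iIndepFun (fun i (N : ℕ → ℕ) => h (N i)) (histLaw n P) :=
    iIndepFun_comp_eval h
  have heq : (fun N : ℕ → ℕ => ∑ i ∈ s, h (N i)) = ∑ i ∈ s, fun N : ℕ → ℕ => h (N i) := by
    ext N; simp
  have hvar : Var[∑ i ∈ s, fun N : ℕ → ℕ => h (N i); histLaw n P] =
      ∑ i ∈ s, Var[fun N : ℕ → ℕ => h (N i); histLaw n P] := by
    refine IndepFun.variance_sum (fun i _ => memLp_comp_eval hB i) ?_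
    intro i _ j _ hij
    exact hindep.indepFun hij
  rw [heq, hvar, ← nsmul_eq_mul]
  refine Finset.sum_le_card_nsmul _ _ _ fun i _ => ?_
  have hmem : ∀ᵐ N ∂histLaw n P, h (N i) ∈ Set.Icc (-B) B :=
    .of_forall fun N => abs_le.1 (hB (N i))
  -- Popoviciu's inequality on `[-B, B]`.
  have hle := variance_le_sq_of_bounded hmem (memLp_comp_eval hB i).aemeasurable
  rwa [show (B - -B) / 2 = B by ring] at hle

/-! ### The estimator as a sum over symbols -/

/-- The contribution of a symbol that is seen `m` times to the error `Ŝ - S`. -/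
noncomputable def symbolError (c₀ c₁ : ℝ) (k n m : ℕ) : ℝ :=
  if m ≤ degL c₀ k then chebCoeff c₀ c₁ k n m else 0

lemma chebEst_sub_card {c₀ c₁ : ℝ} {k n : ℕ} (h0 : chebCoeff c₀ c₁ k n 0 = -1) {N : ℕ → ℕ}
    {s : Finset ℕ} (hN : ∀ i, i ∉ s → N i = 0) :
    chebEst c₀ c₁ k n N - s.card = ∑ i ∈ s, symbolError c₀ c₁ k n (N i) := by
  have hplug : plugIn N = ∑ i ∈ s, if N i = 0 then (0 : ℝ) else 1 := by
    have : {i | 0 < N i} = ((s.filter fun i => ¬ N i = 0 : Finset ℕ) : Set ℕ) := by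
      ext i
      simp only [Set.mem_ofPred_eq, Finset.coe_filter, pos_iff_ne_zero]
      exact ⟨fun h => ⟨by_contra fun hi => h (hN i hi), h⟩, fun h => h.2⟩
    rw [plugIn, this, Set.ncard_coe_finset, Finset.card_filter]
    push_cast
    simp only [ite_not]
  have hfp : ∀ j ∈ Finset.Icc 1 (degL c₀ k),
      fingerprint j N = ∑ i ∈ s, if N i = j then (1 : ℝ) else 0 := by
    intro j hj
    -- Positivity of `j` keeps the symbols outside `s`, which have count `0`, out of the
    -- fingerprint.
    have hj1 := (Finset.mem_Icc.1 hj).1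
    have : {i | N i = j} = ((s.filter fun i => N i = j : Finset ℕ) : Set ℕ) := by
      ext i
      simp only [Set.mem_ofPred_eq, Finset.coe_filter]
      refine ⟨fun h => ⟨by_contra fun hi => ?_, h⟩, fun h => h.2⟩
      have := hN i hi
      omega
    rw [fingerprint, this, Set.ncard_coe_finset, Finset.card_filter]
    push_cast
    rfl
  have hcard : (s.card : ℝ) = ∑ i ∈ s, (1 : ℝ) := by simp
  rw [chebEst, hplug, hcard,
    Finset.sum_congr rfl fun j hj => congrArg (chebCoeff c₀ c₁ k n j * ·) (hfp j hj)]
  simp only [Finset.mul_sum]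
  rw [Finset.sum_comm, ← Finset.sum_add_distrib, ← Finset.sum_sub_distrib]
  refine Finset.sum_congr rfl fun i _ => ?_
  simp only [mul_ite, mul_one, mul_zero, Finset.sum_ite_eq, Finset.mem_Icc, symbolError]
  by_cases hi : N i = 0
  · simp [hi, h0]
  · simp [hi, Nat.one_le_iff_ne_zero]

lemma integral_symbolError {c₀ c₁ : ℝ} {k n : ℕ} (hn : 1 ≤ n) (P : PMF ℕ) (i : ℕ) :
    ∫ N, symbolError c₀ c₁ k n (N i) ∂histLaw n P =
      Real.exp (-(n * (P i).toReal)) *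
        (shiftedCheb (degL c₀ k) (1 / (k : ℝ)) (c₁ * Real.log k / n)).eval (P i).toReal := by
  have hn' : (n : ℝ) ≠ 0 := by exact_mod_cast (by omega : n ≠ 0)
  have hmp := measurePreserving_eval_histLaw n P i
  have h1 := integral_map hmp.measurable.aemeasurable
    (measurable_of_countable (symbolError c₀ c₁ k n)).aestronglyMeasurable (μ := histLaw n P)
  rw [hmp.map_eq] at h1
  rw [← h1, integral_poissonMeasure, tsum_eq_sum (s := Finset.range (degL c₀ k + 1)),
    eval_eq_sum_range' (Nat.lt_succ_of_le (natDegree_shiftedCheb_le _ _ _)), Finset.mul_sum]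
  · refine Finset.sum_congr rfl fun j hj => ?_
    have hj' : j ≤ degL c₀ k := Nat.lt_succ_iff.1 (Finset.mem_range.1 hj)
    rw [symbolError, if_pos hj', chebCoeff, smul_eq_mul]
    push_cast
    rw [mul_pow]
    have : (j.factorial : ℝ) ≠ 0 := by positivity
    field_simp
  · intro j hj
    have hj' : ¬ j ≤ degL c₀ k := fun h => hj (Finset.mem_range.2 (Nat.lt_succ_of_le h))
    rw [symbolError, if_neg hj', smul_zero]

/-! ### Bounds for the estimator -/

/-- The range of parameters in which the bounds hold; `δ = n / (k log k)` is small. -/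
structure Admissible (c₀ δ : ℝ) (k n : ℕ) : Prop where
  pos_c₀ : 0 ≤ c₀
  c₀_le : c₀ ≤ 0.55835
  three_le : 3 ≤ k
  one_le : 1 ≤ n
  delta_eq : δ = (n : ℝ) / (k * Real.log k)
  delta_le : δ ≤ 5e-7

namespace Admissible

variable {c₀ δ : ℝ} {k n : ℕ} (h : Admissible c₀ δ k n)
include h

lemma k_pos : (0 : ℝ) < k := by
  have := h.three_le
  exact_mod_cast (by omega : 0 < k)

lemma n_pos : (0 : ℝ) < n := by
  have := h.one_le
  exact_mod_cast (by omega : 0 < n)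

lemma log_pos : 0 < Real.log k := by
  have := h.three_le
  exact Real.log_pos (by exact_mod_cast (by omega : 1 < k))

lemma delta_pos : 0 < δ := by
  have := h.k_pos
  have := h.n_pos
  have := h.log_pos
  rw [h.delta_eq]
  positivity

lemma degL_le : (degL c₀ k : ℝ) ≤ 0.55835 * Real.log k :=
  (Nat.floor_le (mul_nonneg h.pos_c₀ h.log_pos.le)).trans
    (mul_le_mul_of_nonneg_right h.c₀_le h.log_pos.le)

lemma ratio_eq : 1 / (k : ℝ) / (0.5 * Real.log k / n) = 2 * δ := by
  have := h.k_pos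
  have := h.n_pos
  have := h.log_pos
  rw [h.delta_eq]
  field_simp
  norm_num

lemma right_endpoint_pos : 0 < 0.5 * Real.log k / n := by
  have := h.n_pos
  have := h.log_pos
  positivity

lemma left_le : 1 / (k : ℝ) ≤ 1e-6 * (0.5 * Real.log k / n) := by
  rw [← div_le_iff₀ h.right_endpoint_pos, h.ratio_eq]
  have := h.delta_le
  norm_num at this ⊢
  linarith

lemma log_div_eq : Real.log k / (2 * (0.5 * Real.log k / n)) = n := by
  have := h.n_pos
  have := h.log_pos
  field_simp
  norm_num

lemma chebCoeff_zero : chebCoeff c₀ 0.5 k n 0 = -1 := by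
  have h1 := h.left_le
  have h2 := h.right_endpoint_pos
  have h3 := shiftedCheb_eval_zero (degL c₀ k) (l := 1 / (k : ℝ)) (r := 0.5 * Real.log k / n)
    (by positivity) (by norm_num at h1 h2 ⊢; linarith)
  rw [chebCoeff, coeff_zero_eq_eval_zero, h3]
  simp

lemma abs_symbolError_le (m : ℕ) :
    |symbolError c₀ 0.5 k n m| ≤ Real.exp 1 / 5e-7 * (k : ℝ) ^ (0.4999995 : ℝ) := by
  have hk := h.k_pos
  have hk1 : (1 : ℝ) ≤ k := by
    have := h.three_le
    exact_mod_cast (by omega : 1 ≤ k)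
  have hpow : (1 : ℝ) ≤ (k : ℝ) ^ (0.4999995 : ℝ) := Real.one_le_rpow hk1 (by norm_num)
  have he : (1 : ℝ) ≤ Real.exp 1 / 5e-7 := by
    rw [le_div_iff₀ (by norm_num)]
    have := Real.add_one_le_exp (1 : ℝ)
    norm_num
    linarith
  rw [symbolError]
  split_ifs with hm
  · rcases Nat.eq_zero_or_pos m with rfl | hm0
    · rw [h.chebCoeff_zero, abs_neg, abs_one]
      nlinarith
    · have hb := abs_coeff_shiftedCheb_mul_le h.log_pos h.degL_le (one_div_pos.2 hk) h.left_le hm0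
      rw [h.log_div_eq] at hb
      -- The factor `m ≤ log k` is traded for the power `k ^ 5e-7`, raising the exponent from
      -- `0.499999` to `0.4999995`.
      have hlog := Real.log_le_rpow_div hk.le (by norm_num : (0 : ℝ) < 5e-7)
      have hmM : (m : ℝ) ≤ Real.log k := by
        have h1 : (m : ℝ) ≤ degL c₀ k := by exact_mod_cast hm
        have h2 := h.degL_le
        have h3 := h.log_pos
        norm_num at h2
        linarith
      have hexp : Real.exp (0.499999 * Real.log k) = (k : ℝ) ^ (0.499999 : ℝ) := by
        rw [Real.rpow_def_of_pos hk, mul_comm]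
      rw [chebCoeff, abs_div, abs_mul, abs_of_nonneg (Nat.cast_nonneg (α := ℝ) _),
        abs_of_nonneg (pow_nonneg (Nat.cast_nonneg (α := ℝ) _) _)]
      refine hb.trans ?_
      rw [hexp]
      calc Real.exp 1 * m * (k : ℝ) ^ (0.499999 : ℝ)
          ≤ Real.exp 1 * ((k : ℝ) ^ (5e-7 : ℝ) / 5e-7) * (k : ℝ) ^ (0.499999 : ℝ) := by
            gcongr; exact hmM.trans hlog
        _ = Real.exp 1 / 5e-7 * ((k : ℝ) ^ (5e-7 : ℝ) * (k : ℝ) ^ (0.499999 : ℝ)) := by ring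
        _ = _ := by rw [← Real.rpow_add hk]; norm_num
  · rw [abs_zero]
    positivity

variable {P : PMF ℕ} (hP : P ∈ distClass k)
include hP

lemma finite_support : {i | P i ≠ 0}.Finite := by
  have := h.three_le
  exact SupportSize.finite_support hP (by omega)

lemma suppSize_le : suppSize P ≤ k := by
  have := h.three_le
  rw [suppSize_eq_card (h.finite_support hP)]
  exact_mod_cast card_le_of_subset_support hP (by omega) _ fun i hi => by simpa using hi

lemma chebEst_sub_suppSize_ae_eq :
    (fun N => chebEst c₀ 0.5 k n N - suppSize P) =ᵐ[histLaw n P]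
      fun N => ∑ i ∈ (h.finite_support hP).toFinset, symbolError c₀ 0.5 k n (N i) := by
  filter_upwards [ae_eq_zero_of_notMem_support n P] with N hN
  rw [suppSize_eq_card (h.finite_support hP)]
  exact chebEst_sub_card h.chebCoeff_zero fun i hi => hN i (by simpa using hi)

lemma memLp_chebEst_sub :
    MemLp (fun N => chebEst c₀ 0.5 k n N - suppSize P) 2 (histLaw n P) :=
  (memLp_congr_ae (h.chebEst_sub_suppSize_ae_eq hP)).2 <|
    memLp_finsetSum _ fun i _ => memLp_comp_eval h.abs_symbolError_le i

lemma memLp_chebEst : MemLp (chebEst c₀ 0.5 k n) 2 (histLaw n P) := by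
  have := (h.memLp_chebEst_sub hP).add (memLp_const (suppSize P))
  convert this using 1
  ext N
  simp

lemma variance_chebEst_sub_le :
    Var[fun N => chebEst c₀ 0.5 k n N - suppSize P; histLaw n P] ≤
      (Real.exp 1 / 5e-7) ^ 2 * (suppSize P * (k : ℝ) ^ (0.999999 : ℝ)) := by
  rw [variance_congr (h.chebEst_sub_suppSize_ae_eq hP),
    suppSize_eq_card (h.finite_support hP)]
  refine (variance_sum_comp_eval_le h.abs_symbolError_le _).trans (le_of_eq ?_)
  rw [mul_pow, ← Real.rpow_natCast, ← Real.rpow_natCast, ← Real.rpow_mul h.k_pos.le]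
  norm_num
  ring

lemma variance_chebEst_le :
    Var[chebEst c₀ 0.5 k n; histLaw n P] ≤
      (Real.exp 1 / 5e-7) ^ 2 * (suppSize P * (k : ℝ) ^ (0.999999 : ℝ)) := by
  rw [← variance_sub_const (h.memLp_chebEst hP).aestronglyMeasurable (suppSize P)]
  exact h.variance_chebEst_sub_le hP

lemma abs_bias_le :
    |∫ N, (chebEst c₀ 0.5 k n N - suppSize P) ∂histLaw n P| ≤
      suppSize P * (2 * Real.exp (-(degL c₀ k * (2 * √(2 * δ))))) := by
  rw [integral_congr_ae (h.chebEst_sub_suppSize_ae_eq hP), integral_finsetSum _ fun i _ =>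
      (memLp_comp_eval h.abs_symbolError_le i).integrable (by norm_num),
    suppSize_eq_card (h.finite_support hP), ← nsmul_eq_mul]
  refine (Finset.abs_sum_le_sum_abs _ _).trans (Finset.sum_le_card_nsmul _ _ _ fun i hi => ?_)
  have hi' : P i ≠ 0 := by simpa using hi
  have := exp_neg_mul_abs_eval_shiftedCheb_le h.log_pos.le h.degL_le (one_div_pos.2 h.k_pos)
    h.left_le (hP i hi')
  rw [h.log_div_eq, h.ratio_eq] at this
  rw [integral_symbolError h.one_le, abs_mul, Real.abs_exp]
  exact this

omit hP

/-- The exponent of the bias bound in terms of `A = √(κ n log k / k)`. -/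
lemma exp_degL_le {κ : ℝ} (hκ_pos : 0 < κ) (hκ : κ ≤ 8 * c₀ ^ 2) :
    Real.exp (-(degL c₀ k * (2 * √(2 * δ)))) ≤
      Real.exp (2 * √2 / Real.log k) *
        Real.exp (-(1 + -(2 * √2 / √κ * √δ)) * √(κ * (n * Real.log k / k))) := by
  have hk := h.k_pos
  have hM := h.log_pos
  have hδ := h.delta_pos
  have hA : √(κ * (n * Real.log k / k)) = √κ * √δ * Real.log k := by
    have : κ * (n * Real.log k / k) = κ * δ * Real.log k ^ 2 := by
      rw [h.delta_eq]; field_simp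
    rw [this, Real.sqrt_mul (by positivity), Real.sqrt_sq hM.le, Real.sqrt_mul hκ_pos.le]
  have hL : c₀ * Real.log k - 1 ≤ degL c₀ k := (Nat.sub_one_lt_floor _).le
  have hκ' : √κ ≤ 2 * √2 * c₀ := by
    rw [Real.sqrt_le_left (by have := h.pos_c₀; positivity), mul_pow, mul_pow,
      Real.sq_sqrt (by norm_num)]
    linarith
  have hs : 0 < √κ := Real.sqrt_pos.2 hκ_pos
  rw [hA, Real.sqrt_mul (by norm_num), ← Real.exp_add, Real.exp_le_exp]
  set M := Real.log k
  set u := √δ with hu_def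
  have hu : 0 ≤ u := Real.sqrt_nonneg _
  -- Rounding `L` down costs `2√2 u`, which depends on `δ`. It splits into `1 / M`, a function of
  -- `k` alone, and `u² M`, which is `u / √κ` times the main exponent.
  have hamgm : u ≤ u ^ 2 * M + 1 / M := by
    have : u ^ 2 * M + 1 / M - u = ((u * M - 1) ^ 2 + u * M) / M := by field_simp; ring
    have h2 : 0 ≤ ((u * M - 1) ^ 2 + u * M) / M := by positivity
    linarith
  have h1 : (c₀ * M - 1) * (2 * (√2 * u)) ≤ degL c₀ k * (2 * (√2 * u)) := by gcongr
  have h2 : √κ * (u * M) ≤ 2 * √2 * c₀ * (u * M) := by gcongr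
  have h3 : -(1 + -(2 * √2 / √κ * u)) * (√κ * u * M) = -(√κ * (u * M)) + 2 * √2 * (u ^ 2 * M) := by
    field_simp
    ring
  have h4 : 2 * √2 * u ≤ 2 * √2 * (u ^ 2 * M + 1 / M) := by gcongr
  rw [h3]
  have h5 : 2 * √2 / M = 2 * √2 * (1 / M) := by ring
  rw [h5]
  linarith

/-- The saving `k ^ (-1e-6)` is split: `k ^ (-4e-7)` covers the exponential, since `√(κδ) ≤ 2e-7`,
and `k ^ (-6e-7)` still tends to zero. -/
lemma rpow_le_exp_neg {κ : ℝ} (hκ_pos : 0 < κ) (hκ4 : κ ≤ 4) (hδ' : δ ≤ 1e-14) :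
    (k : ℝ) * (k : ℝ) ^ (0.999999 : ℝ) ≤
      (k : ℝ) ^ 2 * (k : ℝ) ^ (-6e-7 : ℝ) *
        Real.exp (-(2 + -(4 * √2 / √κ * √δ)) * √(κ * (n * Real.log k / k))) := by
  have hk := h.k_pos
  have hM := h.log_pos
  have hδ := h.delta_pos
  have hA : √(κ * (n * Real.log k / k)) ≤ 2e-7 * Real.log k := by
    have : κ * (n * Real.log k / k) = κ * δ * Real.log k ^ 2 := by
      rw [h.delta_eq]; field_simp
    rw [this, Real.sqrt_le_left (by positivity), mul_pow]
    gcongr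
    calc κ * δ ≤ 4 * 1e-14 := by gcongr
      _ = _ := by norm_num
  set A := √(κ * (n * Real.log k / k))
  have hA0 : 0 ≤ A := Real.sqrt_nonneg _
  have hx : 0 ≤ 4 * √2 / √κ * √δ * A := by positivity
  have hexp : (k : ℝ) ^ (-4e-7 : ℝ) ≤ Real.exp (-(2 + -(4 * √2 / √κ * √δ)) * A) := by
    rw [Real.rpow_def_of_pos hk, Real.exp_le_exp]
    norm_num at hA ⊢
    linarith
  refine le_trans (le_of_eq ?_) (mul_le_mul_of_nonneg_left hexp (by positivity))
  rw [← Real.rpow_natCast, ← Real.rpow_add hk, ← Real.rpow_add hk]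
  nth_rw 1 [← Real.rpow_one (k : ℝ)]
  rw [← Real.rpow_add hk]
  norm_num

end Admissible

/-! ### Mean squared error and vanishing error terms -/

lemma lintegral_sq_eq {Ω : Type*} [MeasurableSpace Ω] {μ : Measure Ω} [IsProbabilityMeasure μ]
    {X : Ω → ℝ} (hX : MemLp X 2 μ) :
    ∫⁻ ω, ENNReal.ofReal (X ω ^ 2) ∂μ = ENNReal.ofReal (Var[X; μ] + (∫ ω, X ω ∂μ) ^ 2) := by
  rw [← ofReal_integral_eq_lintegral_ofReal hX.integrable_sq (.of_forall fun ω => sq_nonneg _),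
    variance_eq_sub hX]
  simp

lemma tendsto_exp_div_log_sub_one (a : ℝ) :
    Tendsto (fun k : ℕ => Real.exp (a / Real.log k) - 1) atTop (𝓝 0) := by
  have h1 : Tendsto (fun k : ℕ => a / Real.log k) atTop (𝓝 0) :=
    (Real.tendsto_log_atTop.comp tendsto_natCast_atTop_atTop).const_div_atTop a
  have h2 := (Real.continuous_exp.tendsto 0).comp h1
  simpa using h2.sub_const 1

lemma tendsto_neg_mul_sqrt (a : ℝ) :
    Tendsto (fun δ : ℝ => -(a * √δ)) (𝓝[>] 0) (𝓝 0) := by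
  have : Tendsto (fun δ : ℝ => -(a * √δ)) (𝓝 0) (𝓝 (-(a * √0))) :=
    Continuous.tendsto (by fun_prop) 0
  simpa using this.mono_left nhdsWithin_le_nhds

end SupportSize

open SupportSize in
theorem mainTheorem4 (c₀ c₁ κ : ℝ) (hc₀ : c₀ ∈ Set.Icc (0.558 : ℝ) 0.55835) (hc₁ : c₁ = 0.5)
    (hκ_pos : 0 < κ) (hκ : κ ≤ 4 * c₀ ^ 2 / c₁) :
    ∃ (c C δ₀ : ℝ) (k₀ : ℕ) (ε₁ η₁ : ℕ → ℝ) (ε₂ η₂ : ℝ → ℝ),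
      c < 1 ∧ 0 < δ₀ ∧
      Tendsto ε₁ atTop (𝓝 0) ∧ Tendsto η₁ atTop (𝓝 0) ∧
      Tendsto ε₂ (𝓝[>] 0) (𝓝 0) ∧ Tendsto η₂ (𝓝[>] 0) (𝓝 0) ∧
      ∀ k n : ℕ, k₀ ≤ k → 1 ≤ n → ∀ δ : ℝ, δ = (n : ℝ) / (k * Real.log k) → 0 < δ → δ ≤ δ₀ →
        (∀ P ∈ SupportSize.distClass k,
          MemLp (SupportSize.chebEst c₀ c₁ k n) 2 (SupportSize.histLaw n P) ∧
          |∫ N, (SupportSize.chebEst c₀ c₁ k n N - SupportSize.suppSize P)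
              ∂(SupportSize.histLaw n P)| ≤
            2 * SupportSize.suppSize P * (1 + ε₁ k) *
              Real.exp (-(1 + ε₂ δ) * √(κ * (n * Real.log k / k))) ∧
          Var[SupportSize.chebEst c₀ c₁ k n; SupportSize.histLaw n P] ≤
            C * (SupportSize.suppSize P * (k : ℝ) ^ c)) ∧
        SupportSize.worstCaseMSE k n (SupportSize.chebEst c₀ c₁ k n) ≤
          ENNReal.ofReal (4 * (k : ℝ) ^ 2 * (1 + η₁ k) *
            Real.exp (-(2 + η₂ δ) * √(κ * (n * Real.log k / k)))) := by
  subst hc₁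
  obtain ⟨hc₀l, hc₀u⟩ := hc₀
  have hc₀pos : 0 ≤ c₀ := le_trans (by norm_num) hc₀l
  have hκ8 : κ ≤ 8 * c₀ ^ 2 := hκ.trans (le_of_eq (by ring))
  have hκ4 : κ ≤ 4 := by
    have : c₀ ^ 2 ≤ 0.55835 ^ 2 := by gcongr
    norm_num at this
    linarith
  set D : ℝ := (Real.exp 1 / 5e-7) ^ 2 with hD
  have hD0 : 0 ≤ D := sq_nonneg _
  -- In `η₁`, the first part is the squared bias factor and the second is the variance relative to
  -- `4k²`.
  refine ⟨0.999999, D, 1e-14, 3, fun k => Real.exp (2 * √2 / Real.log k) - 1,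
    fun k => (Real.exp (4 * √2 / Real.log k) - 1) + D / 4 * (k : ℝ) ^ (-6e-7 : ℝ),
    fun δ => -(2 * √2 / √κ * √δ), fun δ => -(4 * √2 / √κ * √δ), by norm_num, by norm_num,
    tendsto_exp_div_log_sub_one _, ?_, tendsto_neg_mul_sqrt _, tendsto_neg_mul_sqrt _, ?_⟩
  · have h1 : Tendsto (fun k : ℕ => (k : ℝ) ^ (-6e-7 : ℝ)) atTop (𝓝 0) := by
      have := (tendsto_rpow_neg_atTop (by norm_num : (0 : ℝ) < 6e-7)).comp
        tendsto_natCast_atTop_atTop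
      simpa [Function.comp_def] using this
    simpa using (tendsto_exp_div_log_sub_one (4 * √2)).add (h1.const_mul (D / 4))
  intro k n hk hn δ hδ hδ0 hδle
  have h : Admissible c₀ δ k n :=
    ⟨hc₀pos, hc₀u, hk, hn, hδ, hδle.trans (by norm_num)⟩
  have hexp := h.exp_degL_le hκ_pos hκ8
  have hrpow := h.rpow_le_exp_neg hκ_pos hκ4 hδle
  set A := √(κ * (n * Real.log k / k)) with hA
  have hS0 (P : PMF ℕ) : 0 ≤ suppSize P := Nat.cast_nonneg _
  have hbias : ∀ P ∈ distClass k, |∫ N, (chebEst c₀ 0.5 k n N - suppSize P) ∂histLaw n P| ≤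
      2 * suppSize P * Real.exp (2 * √2 / Real.log k) *
        Real.exp (-(1 + -(2 * √2 / √κ * √δ)) * A) := by
    intro P hP
    refine (h.abs_bias_le hP).trans ?_
    calc _ = 2 * suppSize P * Real.exp (-(degL c₀ k * (2 * √(2 * δ)))) := by ring
      _ ≤ 2 * suppSize P * (Real.exp (2 * √2 / Real.log k) *
          Real.exp (-(1 + -(2 * √2 / √κ * √δ)) * A)) :=
        mul_le_mul_of_nonneg_left hexp (mul_nonneg zero_le_two (hS0 P))
      _ = _ := by ring
  refine ⟨fun P hP => ⟨h.memLp_chebEst hP, ?_, h.variance_chebEst_le hP⟩, ?_⟩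
  · simpa only [add_sub_cancel] using hbias P hP
  · refine iSup₂_le fun P hP => ?_
    rw [lintegral_sq_eq (h.memLp_chebEst_sub hP)]
    refine ENNReal.ofReal_le_ofReal ?_
    have hSk := h.suppSize_le hP
    have hvar : Var[fun N => chebEst c₀ 0.5 k n N - suppSize P; histLaw n P] ≤
        D * ((k : ℝ) ^ 2 * (k : ℝ) ^ (-6e-7 : ℝ) *
          Real.exp (-(2 + -(4 * √2 / √κ * √δ)) * A)) := by
      refine (h.variance_chebEst_sub_le hP).trans (mul_le_mul_of_nonneg_left ?_ hD0)
      exact (mul_le_mul_of_nonneg_right hSk (by positivity)).trans hrpow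
    have hsq : (∫ N, (chebEst c₀ 0.5 k n N - suppSize P) ∂histLaw n P) ^ 2 ≤
        4 * (k : ℝ) ^ 2 * Real.exp (4 * √2 / Real.log k) *
          Real.exp (-(2 + -(4 * √2 / √κ * √δ)) * A) := by
      rw [← sq_abs]
      refine (pow_le_pow_left₀ (abs_nonneg _) (hbias P hP) 2).trans ?_
      rw [mul_pow, mul_pow, mul_pow, ← Real.exp_nat_mul, ← Real.exp_nat_mul]
      have h1 : ((2 : ℕ) : ℝ) * (2 * √2 / Real.log k) = 4 * √2 / Real.log k := by
        push_cast; ring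
      have h2 : ((2 : ℕ) : ℝ) * (-(1 + -(2 * √2 / √κ * √δ)) * A) =
          -(2 + -(4 * √2 / √κ * √δ)) * A := by
        push_cast; ring
      rw [h1, h2]
      have h3 := pow_le_pow_left₀ (hS0 P) hSk 2
      gcongr
      norm_num
    refine (add_le_add hvar hsq).trans (le_of_eq ?_)
    ring
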